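/- Let $N,k\in\mathbb{N}$ (both $\ge 1$), $p\in(0,\infty)$, and let $X$ be a ball Banach function space on $\mathbb{R}^N$: its norm $\|\cdot\|_X$, taking values in $[0,\infty]$, is defined for all measurable functions, $X=\{f:\|f\|_X<\infty\}$, and (i) $\|\cdot\|_X$ is homogeneous, subadditive, and vanishes only at functions that are $0$ a.e.; (ii) $|g|\le|f|$ a.e. implies $\|g\|_X\le\|f\|_X$; (iii) $0\le f_m\uparrow f$ a.e. implies $\|f_m\|_X\uparrow\|f\|_X$; (iv) $\mathbf 1_B\in X$ for every ball $B$; (v) for every ball $B$ there is $C_B<\infty$ with $\int_B|f|\,dx\le C_B\|f\|_X$ for all $f\in X$. Let $X^{1/p}$ be the $\tfrac1p$-convexification of $X$, that is, $\|f\|_{X^{1/p}}:=\||f|^{1/p}\|_X^p$, and assume that the Hardy--Littlewood maximal operator $\mathcal M f(x)=\sup_{B\ni x}\frac1{|B|}\int_B|f|\,dy$ (supremum over balls) is bounded on $X^{1/p}$. Let $\{\psi_\varepsilon\}_{\varepsilon>0}$ be a family of non-negative functions on $(0,\infty)$ with $$\int_0^\infty\psi_\varepsilon(t)\,dt=1\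 \text{ for all }\varepsilon>0,\qquad \lim_{\varepsilon\to0^+}\int_a^\infty\psi_\varepsilon(t)\,dt=1\ \text{ for every } a>1.$$ Write $\Delta_h^kf(x)=\sum_{j=0}^k(-1)^{j+k}\binom kj f(x+jh)$, and let $|\mathbb S^{N-1}|$ denote the surface measure of the unit sphere of $\mathbb{R}^N$. Then, for every essentially bounded measurable function $f$ with compact support, $$\lim_{\varepsilon\to0^+}\int_0^\infty\left\|\left[\frac1{t^{N/k}}\int_{|h|\le t^{1/k}}|\Delta_h^kf(\cdot)|^p\,dh\right]^{1/p}\right\|_X^p\psi_\varepsilon(t)\,dt=\frac{|\mathbb S^{N-1}|}{N}\,\|f\|_X^p .$$ If, in addition, $X$ has an absolutely continuous norm, meaning that $\|f\mathbf 1_{E_j}\|_X\to0$ for every $f\in X$ and every sequence of measurable sets $E_j$ with $\mathbf 1_{E_j}\to0$ a.e., then this formula holds for all $f\in X$. -/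

import Mathlib

open MeasureTheory Filter Topology Set Metric
open scoped ENNReal NNReal

/-- A ball Banach function space on `ℝ^N`, presented through its function norm on `[0, ∞]`-valued
(Lebesgue) measurable functions: the space consists of the measurable scalar functions `f` with
`‖f‖_X := lnorm |f| < ∞`. Nothing is required of `lnorm` on non-measurable functions. -/
structure BallBanachFunctionSpace (N : ℕ) where
  /-- the function norm -/
  lnorm : (EuclideanSpace ℝ (Fin N) → ℝ≥0∞) → ℝ≥0∞
  /-- definiteness -/
  ae_eq_zero : ∀ g, AEMeasurable g volume → lnorm g = 0 → g =ᵐ[volume] 0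
  /-- homogeneity (in particular `lnorm 0 = 0`) -/
  homogeneous : ∀ (c : ℝ≥0) (g), AEMeasurable g volume →
    lnorm (fun x => (c : ℝ≥0∞) * g x) = (c : ℝ≥0∞) * lnorm g
  /-- triangle inequality -/
  triangle : ∀ g₁ g₂, AEMeasurable g₁ volume → AEMeasurable g₂ volume →
    lnorm (fun x => g₁ x + g₂ x) ≤ lnorm g₁ + lnorm g₂
  /-- lattice property -/
  lattice : ∀ g₁ g₂, AEMeasurable g₁ volume → AEMeasurable g₂ volume →
    g₁ ≤ᵐ[volume] g₂ → lnorm g₁ ≤ lnorm g₂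
  /-- Fatou property: `0 ≤ gₘ ↑ g` a.e. implies `‖gₘ‖ ↑ ‖g‖` -/
  fatou : ∀ (g : ℕ → EuclideanSpace ℝ (Fin N) → ℝ≥0∞) (g' : EuclideanSpace ℝ (Fin N) → ℝ≥0∞),
    (∀ m, AEMeasurable (g m) volume) → AEMeasurable g' volume →
    (∀ᵐ x ∂volume, Monotone fun m => g m x) →
    (∀ᵐ x ∂volume, Tendsto (fun m => g m x) atTop (𝓝 (g' x))) →
    Tendsto (fun m => lnorm (g m)) atTop (𝓝 (lnorm g'))
  /-- indicator functions of balls belong to the space -/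
  ball_mem : ∀ (c : EuclideanSpace ℝ (Fin N)) (r : ℝ), 0 < r →
    lnorm ((ball c r).indicator 1) < ∞
  /-- elements of the space are integrable on balls, with a norm bound -/
  lintegral_ball_le : ∀ (c : EuclideanSpace ℝ (Fin N)) (r : ℝ), 0 < r →
    ∃ C : ℝ≥0, ∀ g, AEMeasurable g volume → ∫⁻ x in ball c r, g x ≤ (C : ℝ≥0∞) * lnorm g

/-- The (uncentred) Hardy–Littlewood maximal function
`M g (x) = sup { |B|⁻¹ ∫_B g : B a ball containing x }` of a `[0, ∞]`-valued function. -/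
noncomputable def hlMaximal {N : ℕ} (g : EuclideanSpace ℝ (Fin N) → ℝ≥0∞)
    (x : EuclideanSpace ℝ (Fin N)) : ℝ≥0∞ :=
  ⨆ (c : EuclideanSpace ℝ (Fin N)) (r : ℝ) (_ : x ∈ ball c r),
    (volume (ball c r))⁻¹ * ∫⁻ y in ball c r, g y

namespace BallBanachFunctionSpace

variable {N : ℕ} {𝕜 : Type*} [RCLike 𝕜]

/-- `‖f‖_X ∈ [0, ∞]` of a scalar function `f`. -/
noncomputable def fnorm (X : BallBanachFunctionSpace N) (f : EuclideanSpace ℝ (Fin N) → 𝕜) :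
    ℝ≥0∞ :=
  X.lnorm fun x => ‖f x‖ₑ

/-- `f ∈ X`. -/
def Mem (X : BallBanachFunctionSpace N) (f : EuclideanSpace ℝ (Fin N) → 𝕜) : Prop :=
  AEStronglyMeasurable f volume ∧ X.fnorm f < ∞

/-- The norm `‖g‖_{X^{1/p}} = ‖ |g|^{1/p} ‖_X ^ p` of the `1/p`-convexification of `X`. -/
noncomputable def convexNorm (X : BallBanachFunctionSpace N) (p : ℝ)
    (g : EuclideanSpace ℝ (Fin N) → ℝ≥0∞) : ℝ≥0∞ :=
  (X.lnorm fun x => g x ^ (1 / p)) ^ p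

/-- The Hardy–Littlewood maximal operator is bounded on `X^{1/p}`. -/
def MaximalBounded (X : BallBanachFunctionSpace N) (p : ℝ) : Prop :=
  ∃ C : ℝ≥0, ∀ g : EuclideanSpace ℝ (Fin N) → ℝ≥0∞, AEMeasurable g volume →
    X.convexNorm p g < ∞ → X.convexNorm p (hlMaximal g) ≤ (C : ℝ≥0∞) * X.convexNorm p g

/-- `X` has an absolutely continuous norm: `‖g 1_{E_j}‖_X → 0` for every `g` in the space and all
measurable sets `E_j` with `1_{E_j} → 0` almost everywhere (that is, almost every point lies in
only finitely many `E_j`). -/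
def AbsolutelyContinuousNorm (X : BallBanachFunctionSpace N) : Prop :=
  ∀ g : EuclideanSpace ℝ (Fin N) → ℝ≥0∞, AEMeasurable g volume → X.lnorm g < ∞ →
    ∀ E : ℕ → Set (EuclideanSpace ℝ (Fin N)), (∀ j, MeasurableSet (E j)) →
      (∀ᵐ x ∂volume, ∀ᶠ j in atTop, x ∉ E j) →
      Tendsto (fun j => X.lnorm ((E j).indicator g)) atTop (𝓝 0)

/-- The averaged difference
`[ t^{-N/k} ∫_{|h| ≤ t^{1/k}} |Δ_h^k f(x)|^p dh ]^{1/p}`, for `t > 0`. -/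
noncomputable def avgDiff (p : ℝ) (k : ℕ) (f : EuclideanSpace ℝ (Fin N) → 𝕜) (t : ℝ)
    (x : EuclideanSpace ℝ (Fin N)) : ℝ≥0∞ :=
  ((∫⁻ h in closedBall (0 : EuclideanSpace ℝ (Fin N)) (t ^ (1 / (k : ℝ))),
      ‖((fwdDiff h)^[k] f) x‖ₑ ^ p) / ENNReal.ofReal (t ^ ((N : ℝ) / (k : ℝ)))) ^ (1 / p)

/-- The functional `∫_0^∞ ‖ averaged difference at scale t ‖_X ^ p w(t) dt`. -/
noncomputable def avgDiffFunctional (X : BallBanachFunctionSpace N) (p : ℝ) (k : ℕ)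
    (f : EuclideanSpace ℝ (Fin N) → 𝕜) (w : ℝ → ℝ) : ℝ≥0∞ :=
  ∫⁻ t in Ioi (0 : ℝ), X.lnorm (avgDiff p k f t) ^ p * ENNReal.ofReal (w t)

end BallBanachFunctionSpace

/-- `f ∈ L^∞_c(ℝ^N)`: `f` is essentially bounded and vanishes a.e. off some compact set. -/
def MemLinftyCompact {N : ℕ} {𝕜 : Type*} [RCLike 𝕜] (f : EuclideanSpace ℝ (Fin N) → 𝕜) : Prop :=
  MemLp f ∞ volume ∧
    ∃ K : Set (EuclideanSpace ℝ (Fin N)), IsCompact K ∧ ∀ᵐ x ∂volume, x ∉ K → f x = 0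

/-- `(ψ_ε)_{ε > 0}` is a family of non-negative functions on `(0, ∞)` of integral one, which
concentrates at `∞` as `ε → 0⁺`. -/
structure ConcentratesAtInfinity (ψ : ℝ → ℝ → ℝ) : Prop where
  nonneg : ∀ ε, 0 < ε → ∀ t, 0 < t → 0 ≤ ψ ε t
  integrableOn : ∀ ε, 0 < ε → IntegrableOn (ψ ε) (Ioi 0) volume
  integral_eq_one : ∀ ε, 0 < ε → ∫ t in Ioi (0 : ℝ), ψ ε t = 1
  tendsto_tail : ∀ a : ℝ, 1 < a →
    Tendsto (fun ε => ∫ t in Ioi a, ψ ε t) (𝓝[>] 0) (𝓝 1)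

/-!
Write `R = t^{1/k}`, `g = |f|^p`, `Y = X^{1/p}`, and let `D_R` be the mean over `|h| ≤ R` of
`|Δ_h^k f|^p`, normalised by `R^N`; the inner quantity of the functional is then `‖D_R‖_Y`.

The `k`-th difference is `± f(x)` plus a combination of `f(x + jh)`, `1 ≤ j ≤ k`. Since
`(a + b)^q ≤ (1 + δ) a^q + C_δ b^q` for every exponent `q > 0` (`exists_add_rpow_le`), `D_R` agrees
with `|B_1| g`, up to factors `1 + δ`, modulo `C_δ` times the sum of the averages `A_{jR} g` of `g`
over balls of radius `jR` (`exists_diffAverage_le`). The same inequality gives a quasi-triangle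
inequality in `Y` with leading constant `1 + δ` (`exists_convexNorm_add_le`), so
`‖D_R‖_Y → |B_1| ‖g‖_Y = |B_1| ‖f‖_X^p` as soon as `‖A_ρ g‖_Y → 0` as `ρ → ∞`. Moreover
`A_ρ g ≤ |B_1| M g`, so `‖D_R‖_Y` is bounded in `R`, and averaging against weights that concentrate
at infinity gives the limit formula (`tendsto_avgDiffFunctional_of_tendsto_ballAverage`).

For bounded `g` of bounded support, `A_ρ g` is at most a multiple of `ρ^{-N} 1_{B_{2ρ}}`, so what is
needed is `R^{-N} ‖1_{B_R}‖_Y → 0`. This follows by applying the maximal operator twice: the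
function `w = M 1_{B_1}` is not integrable, and `R^{-N} (∫_{B_R} w) 1_{B_R} ≤ |B_1| M w`, where
`‖M w‖_Y < ∞` (`tendsto_convexNorm_indicator_ball`). If the norm is absolutely continuous, truncation
and the uniform bound on `A_ρ` extend `‖A_ρ g‖_Y → 0` to all `g` in `Y`
(`tendsto_convexNorm_ballAverage_of_absolutelyContinuousNorm`).
-/

/-! ### Inequalities and limits in `[0, ∞]` -/

/-- The triangle inequality for `q`-th powers, valid for every exponent `q > 0`, with a constant
as close to one as desired in front of the first term. -/
theorem exists_add_rpow_le {q : ℝ} (hq : 0 < q) {δ : ℝ≥0} (hδ : 0 < δ) :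
    ∃ C : ℝ≥0, ∀ a b : ℝ≥0∞, (a + b) ^ q ≤ (1 + δ) * a ^ q + C * b ^ q := by
  have h1 : (1 : ℝ≥0) < (1 + δ) ^ (1 / q) :=
    NNReal.one_lt_rpow (by simpa using hδ) (by positivity)
  obtain ⟨η, hη⟩ := exists_add_of_le h1.le
  have hη0 : η ≠ 0 := by
    rintro rfl
    rw [hη, add_zero] at h1
    exact h1.false
  have h2 : ((1 + η : ℝ≥0) : ℝ≥0∞) ^ q = 1 + δ := by
    rw [← hη, ← ENNReal.coe_rpow_of_nonneg _ hq.le, ← NNReal.rpow_mul, one_div_mul_cancel hq.ne']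
    simp
  refine ⟨(1 + η⁻¹) ^ q, fun a b => ?_⟩
  rcases le_total b (η * a) with h | h
  · calc (a + b) ^ q ≤ (((1 + η : ℝ≥0) : ℝ≥0∞) * a) ^ q := by
          gcongr
          rw [ENNReal.coe_add, add_mul]
          simpa using add_le_add_right h a
      _ = (1 + δ) * a ^ q := by rw [ENNReal.mul_rpow_of_nonneg _ _ hq.le, h2]
      _ ≤ _ := le_self_add
  · have h' : a ≤ ((η⁻¹ : ℝ≥0) : ℝ≥0∞) * b := by
      calc a = ((η⁻¹ : ℝ≥0) : ℝ≥0∞) * (η * a) := by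
            rw [← mul_assoc, ← ENNReal.coe_mul, inv_mul_cancel₀ hη0]; simp
        _ ≤ _ := by gcongr
    calc (a + b) ^ q ≤ (((1 + η⁻¹ : ℝ≥0) : ℝ≥0∞) * b) ^ q := by
          gcongr
          rw [ENNReal.coe_add, add_mul, add_comm]
          simpa using add_le_add_right h' b
      _ = (((1 + η⁻¹) ^ q : ℝ≥0) : ℝ≥0∞) * b ^ q := by
          rw [ENNReal.mul_rpow_of_nonneg _ _ hq.le, ENNReal.coe_rpow_of_nonneg _ hq.le]
      _ ≤ _ := le_add_self

theorem sum_rpow_le_card_rpow_mul_sum {ι : Type*} (s : Finset ι) {q : ℝ} (hq : 0 < q)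
    (b : ι → ℝ≥0∞) : (∑ i ∈ s, b i) ^ q ≤ (s.card : ℝ≥0∞) ^ q * ∑ i ∈ s, b i ^ q := by
  have h : ∑ i ∈ s, b i ≤ s.card * (∑ i ∈ s, b i ^ q) ^ (1 / q) := by
    rw [← nsmul_eq_mul]
    refine Finset.sum_le_card_nsmul _ _ _ fun i hi => ?_
    calc b i = (b i ^ q) ^ (1 / q) := by
          rw [← ENNReal.rpow_mul, mul_one_div_cancel hq.ne', ENNReal.rpow_one]
      _ ≤ _ := by
          gcongr
          exact Finset.single_le_sum (f := fun i => b i ^ q) (fun _ _ => zero_le) hi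
  calc _ ≤ (s.card * (∑ i ∈ s, b i ^ q) ^ (1 / q)) ^ q := by gcongr
    _ = _ := by
      rw [ENNReal.mul_rpow_of_nonneg _ _ hq.le, ← ENNReal.rpow_mul, one_div_mul_cancel hq.ne',
        ENNReal.rpow_one]

theorem exists_one_add_mul_lt {a b : ℝ≥0∞} (hab : a < b) :
    ∃ δ : ℝ≥0, 0 < δ ∧ (1 + δ) * a < b := by
  have h : Tendsto (fun δ : ℝ≥0 => (1 + (δ : ℝ≥0∞)) * a) (𝓝[>] 0) (𝓝 ((1 + (0 : ℝ≥0)) * a)) := by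
    refine Tendsto.mono_left ?_ nhdsWithin_le_nhds
    refine ENNReal.Tendsto.mul_const ?_ (Or.inr hab.ne_top)
    exact tendsto_const_nhds.add (ENNReal.tendsto_coe.2 tendsto_id)
  have h' := (h.eventually (gt_mem_nhds (by simpa using hab))).and self_mem_nhdsWithin
  obtain ⟨δ, h1, h2⟩ := h'.exists
  exact ⟨δ, h2, h1⟩

/-- A function which agrees with `L` up to factors arbitrarily close to one and multiples of a
null function tends to `L`. -/
theorem tendsto_of_forall_le_one_add_mul {α : Type*} {l : Filter α} {u e : α → ℝ≥0∞} {L : ℝ≥0∞}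
    (he : Tendsto e l (𝓝 0))
    (h : ∀ δ : ℝ≥0, 0 < δ → ∃ C : ℝ≥0, ∀ᶠ t in l,
      u t ≤ (1 + δ) * L + C * e t ∧ L ≤ (1 + δ) * u t + C * e t) :
    Tendsto u l (𝓝 L) := by
  have key (c : ℝ≥0∞) (C : ℝ≥0) : Tendsto (fun t => c + C * e t) l (𝓝 c) := by
    simpa using tendsto_const_nhds.add (ENNReal.Tendsto.const_mul he (Or.inr ENNReal.coe_ne_top))
  refine tendsto_order.2 ⟨fun a ha => ?_, fun a ha => ?_⟩
  · obtain ⟨δ, hδ, hlt⟩ := exists_one_add_mul_lt ha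
    obtain ⟨C, hC⟩ := h δ hδ
    filter_upwards [hC, (key ((1 + δ) * a) C).eventually (gt_mem_nhds hlt)] with t h1 h2
    by_contra! hcon
    refine absurd (h1.2.trans ?_) (not_le.2 h2)
    gcongr
  · obtain ⟨δ, hδ, hlt⟩ := exists_one_add_mul_lt ha
    obtain ⟨C, hC⟩ := h δ hδ
    filter_upwards [hC, (key ((1 + δ) * L) C).eventually (gt_mem_nhds hlt)] with t h1 h2
    exact h1.1.trans_lt h2

/-! ### Averages against weights concentrating at infinity -/

namespace ConcentratesAtInfinity

variable {ψ : ℝ → ℝ → ℝ}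

theorem lintegral_ofReal_eq (hψ : ConcentratesAtInfinity ψ) {ε : ℝ} (hε : 0 < ε) {s : Set ℝ}
    (hs : MeasurableSet s) (hs0 : s ⊆ Ioi 0) :
    ∫⁻ t in s, ENNReal.ofReal (ψ ε t) = ENNReal.ofReal (∫ t in s, ψ ε t) :=
  (ofReal_integral_eq_lintegral_ofReal ((hψ.integrableOn ε hε).mono_set hs0)
    ((ae_restrict_iff' hs).2 (ae_of_all _ fun t ht => hψ.nonneg ε hε t (hs0 ht)))).symm

theorem tendsto_lintegral_Ioi (hψ : ConcentratesAtInfinity ψ) {a : ℝ} (ha : 1 < a) :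
    Tendsto (fun ε => ∫⁻ t in Ioi a, ENNReal.ofReal (ψ ε t)) (𝓝[>] 0) (𝓝 1) := by
  have h := ENNReal.tendsto_ofReal (hψ.tendsto_tail a ha)
  rw [ENNReal.ofReal_one] at h
  refine h.congr' ?_
  filter_upwards [self_mem_nhdsWithin] with ε hε
  exact (hψ.lintegral_ofReal_eq hε measurableSet_Ioi (Ioi_subset_Ioi (by linarith))).symm

theorem tendsto_lintegral_Ioc (hψ : ConcentratesAtInfinity ψ) {a : ℝ} (ha : 1 < a) :
    Tendsto (fun ε => ∫⁻ t in Ioc 0 a, ENNReal.ofReal (ψ ε t)) (𝓝[>] 0) (𝓝 0) := by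
  have h := ENNReal.tendsto_ofReal ((tendsto_const_nhds (x := (1 : ℝ))).sub
    (hψ.tendsto_tail a ha))
  rw [sub_self, ENNReal.ofReal_zero] at h
  refine h.congr' ?_
  filter_upwards [self_mem_nhdsWithin] with ε hε
  rw [hψ.lintegral_ofReal_eq hε measurableSet_Ioc Ioc_subset_Ioi_self,
    ← hψ.integral_eq_one ε hε, ← Ioc_union_Ioi_eq_Ioi (show (0 : ℝ) ≤ a by linarith),
    setIntegral_union (Ioc_disjoint_Ioi le_rfl) measurableSet_Ioi
      ((hψ.integrableOn ε hε).mono_set Ioc_subset_Ioi_self)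
      ((hψ.integrableOn ε hε).mono_set (Ioi_subset_Ioi (by linarith)))]
  simp

/-- Weighted means of a bounded function against the weights `ψ ε` tend to its limit at infinity.
The function need not be measurable: the lower integral is only compared with integrals of
constants. -/
theorem tendsto_lintegral_mul (hψ : ConcentratesAtInfinity ψ) {F : ℝ → ℝ≥0∞} {K L : ℝ≥0∞}
    (hK : K ≠ ∞) (hF : ∀ t, 0 < t → F t ≤ K) (hlim : Tendsto F atTop (𝓝 L)) :
    Tendsto (fun ε => ∫⁻ t in Ioi (0 : ℝ), F t * ENNReal.ofReal (ψ ε t)) (𝓝[>] 0) (𝓝 L) := by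
  refine tendsto_order.2 ⟨fun b hb => ?_, fun b hb => ?_⟩
  · obtain ⟨c, hbc, hcL⟩ := exists_between hb
    obtain ⟨a, ha1, ha⟩ := ((eventually_gt_atTop (1 : ℝ)).and
      (eventually_forall_ge_atTop.2 (hlim.eventually (lt_mem_nhds hcL)))).exists
    have h : Tendsto (fun ε => c * ∫⁻ t in Ioi a, ENNReal.ofReal (ψ ε t)) (𝓝[>] 0) (𝓝 (c * 1)) :=
      ENNReal.Tendsto.const_mul (hψ.tendsto_lintegral_Ioi ha1) (Or.inr hcL.ne_top)
    rw [mul_one] at h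
    filter_upwards [h.eventually (lt_mem_nhds hbc)] with ε hε
    refine hε.trans_le ?_
    rw [← lintegral_const_mul' _ _ hcL.ne_top]
    refine (setLIntegral_mono' measurableSet_Ioi fun t ht => ?_).trans
      (lintegral_mono_set (Ioi_subset_Ioi (by linarith : (0 : ℝ) ≤ a)))
    gcongr
    exact (ha t (le_of_lt ht)).le
  · obtain ⟨c, hLc, hcb⟩ := exists_between hb
    obtain ⟨a, ha1, ha⟩ := ((eventually_gt_atTop (1 : ℝ)).and
      (eventually_forall_ge_atTop.2 (hlim.eventually (gt_mem_nhds hLc)))).exists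
    have h : Tendsto (fun ε => (K * ∫⁻ t in Ioc 0 a, ENNReal.ofReal (ψ ε t)) +
        c * ∫⁻ t in Ioi a, ENNReal.ofReal (ψ ε t)) (𝓝[>] 0) (𝓝 (K * 0 + c * 1)) :=
      (ENNReal.Tendsto.const_mul (hψ.tendsto_lintegral_Ioc ha1) (Or.inr hK)).add
        (ENNReal.Tendsto.const_mul (hψ.tendsto_lintegral_Ioi ha1) (Or.inr hcb.ne_top))
    rw [mul_one, mul_zero, zero_add] at h
    filter_upwards [h.eventually (gt_mem_nhds hcb)] with ε hε
    refine lt_of_le_of_lt ?_ hε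
    rw [← Ioc_union_Ioi_eq_Ioi (show (0 : ℝ) ≤ a by linarith)]
    refine (lintegral_union_le _ _ _).trans ?_
    rw [← lintegral_const_mul' _ _ hcb.ne_top, ← lintegral_const_mul' _ _ hK]
    refine add_le_add (setLIntegral_mono' measurableSet_Ioc fun t ht => ?_)
      (setLIntegral_mono' measurableSet_Ioi fun t ht => ?_)
    · gcongr
      exact hF t ht.1
    · gcongr
      exact (ha t (le_of_lt ht)).le

end ConcentratesAtInfinity

/-! ### The maximal function and averages over balls -/

section BallAverage

variable {N : ℕ}

theorem volume_ball_eq_ofReal_pow_mul (x : EuclideanSpace ℝ (Fin N)) {r : ℝ} (hr : 0 < r) :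
    volume (ball x r) =
      ENNReal.ofReal (r ^ N) * volume (ball (0 : EuclideanSpace ℝ (Fin N)) 1) := by
  simpa using Measure.addHaar_ball_of_pos volume x hr

/-- The maximal function is lower semicontinuous, hence measurable. -/
theorem measurable_hlMaximal (g : EuclideanSpace ℝ (Fin N) → ℝ≥0∞) :
    Measurable (hlMaximal g) := by
  refine measurable_of_Ioi fun a => IsOpen.measurableSet ?_
  have h : hlMaximal g ⁻¹' Ioi a = ⋃ (c : EuclideanSpace ℝ (Fin N)) (r : ℝ)
      (_ : a < (volume (ball c r))⁻¹ * ∫⁻ y in ball c r, g y), ball c r := by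
    ext x
    simp only [hlMaximal, mem_preimage, mem_Ioi, lt_iSup_iff, mem_iUnion]
    exact exists_congr fun c => exists_congr fun r => ⟨fun ⟨h1, h2⟩ => ⟨h2, h1⟩,
      fun ⟨h1, h2⟩ => ⟨h2, h1⟩⟩
  rw [h]
  exact isOpen_iUnion fun c => isOpen_iUnion fun r => isOpen_iUnion fun _ => isOpen_ball

theorem setLIntegral_ball_le_mul_hlMaximal (g : EuclideanSpace ℝ (Fin N) → ℝ≥0∞)
    {x c : EuclideanSpace ℝ (Fin N)} {r : ℝ} (hx : x ∈ ball c r) :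
    ∫⁻ y in ball c r, g y ≤ volume (ball c r) * hlMaximal g x := by
  have hr : 0 < r := pos_of_mem_ball hx
  calc ∫⁻ y in ball c r, g y
      = volume (ball c r) * ((volume (ball c r))⁻¹ * ∫⁻ y in ball c r, g y) := by
        rw [← mul_assoc, ENNReal.mul_inv_cancel (measure_ball_pos _ _ hr).ne'
          measure_ball_lt_top.ne, one_mul]
    _ ≤ _ := by
        gcongr
        exact le_iSup_of_le c (le_iSup_of_le r (le_iSup_of_le hx le_rfl))

/-- The mean `ρ⁻ᴺ ∫_{|y - x| ≤ ρ} g`, normalised by `ρᴺ` instead of the volume of the ball. -/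
noncomputable def ballAverage (ρ : ℝ) (g : EuclideanSpace ℝ (Fin N) → ℝ≥0∞)
    (x : EuclideanSpace ℝ (Fin N)) : ℝ≥0∞ :=
  (∫⁻ y in closedBall x ρ, g y) / ENNReal.ofReal (ρ ^ N)

theorem measurable_ballAverage (ρ : ℝ) {g : EuclideanSpace ℝ (Fin N) → ℝ≥0∞}
    (hg : Measurable g) : Measurable (ballAverage ρ g) := by
  refine Measurable.div_const ?_ _
  have h : (fun x => ∫⁻ y in closedBall x ρ, g y) = fun x => ∫⁻ y,
      {z : EuclideanSpace ℝ (Fin N) × EuclideanSpace ℝ (Fin N) | dist z.2 z.1 ≤ ρ}.indicator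
        (fun z => g z.2) (x, y) := by
    ext x
    rw [← lintegral_indicator measurableSet_closedBall]
    rfl
  rw [h]
  refine Measurable.lintegral_prod_right ((hg.comp measurable_snd).indicator ?_)
  exact measurableSet_le (measurable_snd.dist measurable_fst) measurable_const

theorem ballAverage_le_mul_hlMaximal {ρ : ℝ} (hρ : 0 < ρ) (g : EuclideanSpace ℝ (Fin N) → ℝ≥0∞)
    (x : EuclideanSpace ℝ (Fin N)) :
    ballAverage ρ g x ≤ volume (ball (0 : EuclideanSpace ℝ (Fin N)) 1) * hlMaximal g x := by
  have h := setLIntegral_ball_le_mul_hlMaximal g (mem_ball_self (x := x) hρ)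
  rw [volume_ball_eq_ofReal_pow_mul x hρ] at h
  refine ENNReal.div_le_of_le_mul ?_
  have h0 : (closedBall x ρ : Set (EuclideanSpace ℝ (Fin N))) =ᵐ[volume] ball x ρ := by
    have hs : volume (sphere x ρ) = 0 := Measure.addHaar_sphere_of_ne_zero volume x hρ.ne'
    rw [← ball_union_sphere]
    exact union_ae_eq_left_of_ae_eq_empty (ae_eq_empty.2 hs)
  rw [setLIntegral_congr h0]
  refine h.trans_eq ?_
  ring

theorem ballAverage_mono {ρ : ℝ} {g₁ g₂ : EuclideanSpace ℝ (Fin N) → ℝ≥0∞}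
    (h : g₁ ≤ᵐ[volume] g₂) (x : EuclideanSpace ℝ (Fin N)) :
    ballAverage ρ g₁ x ≤ ballAverage ρ g₂ x :=
  ENNReal.div_le_div_right (lintegral_mono_ae (ae_restrict_of_ae h)) _

theorem ballAverage_add {ρ : ℝ} {g₁ g₂ : EuclideanSpace ℝ (Fin N) → ℝ≥0∞}
    (h : Measurable g₁) (x : EuclideanSpace ℝ (Fin N)) :
    ballAverage ρ (fun y => g₁ y + g₂ y) x = ballAverage ρ g₁ x + ballAverage ρ g₂ x := by
  rw [ballAverage, lintegral_add_left h, ENNReal.add_div]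
  rfl

/-- The mean of a bounded function supported in `ball 0 r` decays like `ρ⁻ᴺ`, and lives in a ball
of radius comparable to `ρ`. -/
theorem ballAverage_indicator_le {r ρ : ℝ} (hr : 0 < r) (hρ : r ≤ ρ) (M : ℝ≥0∞)
    (x : EuclideanSpace ℝ (Fin N)) :
    ballAverage ρ ((ball 0 r).indicator fun _ => M) x ≤
      (2 ^ N * (M * volume (ball (0 : EuclideanSpace ℝ (Fin N)) r))) *
        ((ENNReal.ofReal ((2 * ρ) ^ N))⁻¹ * (ball 0 (2 * ρ)).indicator 1 x) := by
  have hρ0 : 0 < ρ := hr.trans_le hρ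
  have hpow : ENNReal.ofReal ((2 * ρ) ^ N) = 2 ^ N * ENNReal.ofReal (ρ ^ N) := by
    rw [mul_pow, ENNReal.ofReal_mul (by positivity), ENNReal.ofReal_pow (by positivity)]
    simp
  by_cases hx : x ∈ ball 0 (2 * ρ)
  · have h2 : (2 ^ N : ℝ≥0∞) * (2 ^ N)⁻¹ = 1 :=
      ENNReal.mul_inv_cancel (by positivity) (ENNReal.pow_ne_top (by simp))
    calc ballAverage ρ ((ball 0 r).indicator fun _ => M) x
        ≤ (∫⁻ y, (ball 0 r).indicator (fun _ => M) y) / ENNReal.ofReal (ρ ^ N) :=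
          ENNReal.div_le_div_right (setLIntegral_le_lintegral _ _) _
      _ = (M * volume (ball (0 : EuclideanSpace ℝ (Fin N)) r)) * (ENNReal.ofReal (ρ ^ N))⁻¹ := by
          rw [lintegral_indicator_const measurableSet_ball, div_eq_mul_inv]
      _ = (2 ^ N * (2 ^ N)⁻¹) * ((M * volume (ball (0 : EuclideanSpace ℝ (Fin N)) r)) *
            (ENNReal.ofReal (ρ ^ N))⁻¹) := by rw [h2, one_mul]
      _ = _ := by
          rw [hpow, ENNReal.mul_inv (Or.inl (by positivity))
            (Or.inl (ENNReal.pow_ne_top (by simp))), indicator_of_mem hx, Pi.one_apply]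
          ring
  · have h0 : ∫⁻ y in closedBall x ρ, (ball 0 r).indicator (fun _ => M) y = 0 := by
      rw [setLIntegral_congr_fun (g := fun _ => 0) measurableSet_closedBall]
      · simp
      · intro y hy
        refine indicator_of_notMem (fun hy' => hx ?_) _
        rw [mem_ball] at *
        rw [mem_closedBall, dist_comm] at hy
        linarith [dist_triangle x y 0]
    simp [ballAverage, h0]

/-- The maximal function of the indicator of the unit ball fails to be integrable: it decays only
like `|x|⁻ᴺ`, so each dyadic annulus contributes at least the same amount to its integral. -/
theorem tendsto_lintegral_hlMaximal_indicator (hN : 0 < N) :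
    Tendsto (fun R : ℝ => ∫⁻ x in ball (0 : EuclideanSpace ℝ (Fin N)) R,
      hlMaximal ((ball 0 1).indicator 1) x) atTop (𝓝 ∞) := by
  set w : EuclideanSpace ℝ (Fin N) → ℝ≥0∞ := hlMaximal ((ball 0 1).indicator 1) with hw
  set V := volume (ball (0 : EuclideanSpace ℝ (Fin N)) 1) with hV
  have hV0 : V ≠ 0 := (measure_ball_pos _ _ one_pos).ne'
  have hVt : V ≠ ∞ := measure_ball_lt_top.ne
  have hlow {ρ : ℝ} (hρ : 1 ≤ ρ) {x : EuclideanSpace ℝ (Fin N)} (hx : x ∈ ball 0 ρ) :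
      (ENNReal.ofReal (ρ ^ N))⁻¹ ≤ w x := by
    have h := setLIntegral_ball_le_mul_hlMaximal ((ball 0 1).indicator 1) hx
    rw [setLIntegral_indicator measurableSet_ball, inter_eq_left.2 (ball_subset_ball hρ),
      volume_ball_eq_ofReal_pow_mul _ (by linarith), ← hV, ← hw] at h
    simp only [Pi.one_apply, setLIntegral_one, ← hV] at h
    have hT0 : ENNReal.ofReal (ρ ^ N) ≠ 0 := by simpa using by positivity
    rw [ENNReal.inv_le_iff_le_mul (fun _ => hT0) (fun h => absurd h ENNReal.ofReal_ne_top)]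
    rw [mul_comm _ V, mul_assoc] at h
    simpa using (ENNReal.mul_le_mul_iff_right hV0 hVt).1 ((mul_one V).trans_le h)
  have hann (n : ℕ) : V * 2⁻¹ ≤
      ∫⁻ x in ball (0 : EuclideanSpace ℝ (Fin N)) (2 ^ (n + 1)) \ ball 0 (2 ^ n), w x := by
    have hρ : (1 : ℝ) ≤ 2 ^ n := one_le_pow₀ one_le_two
    set A := ball (0 : EuclideanSpace ℝ (Fin N)) (2 ^ (n + 1)) \ ball 0 (2 ^ n) with hA
    set T := ENNReal.ofReal (((2 : ℝ) ^ (n + 1)) ^ N) with hT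
    have hTV : volume (ball (0 : EuclideanSpace ℝ (Fin N)) (2 ^ (n + 1))) = T * V :=
      volume_ball_eq_ofReal_pow_mul _ (by positivity)
    have hT0 : T ≠ 0 := by simp [hT]
    -- doubling the radius at least doubles the volume, so the annulus carries half of it
    have hhalf : volume (ball (0 : EuclideanSpace ℝ (Fin N)) (2 ^ n)) ≤ T * V * 2⁻¹ := by
      rw [volume_ball_eq_ofReal_pow_mul _ (by positivity), ← hV, mul_right_comm, mul_comm T,
        ← ENNReal.ofReal_ofNat, ← ENNReal.ofReal_inv_of_pos two_pos, hT,
        ← ENNReal.ofReal_mul (by positivity)]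
      gcongr
      have h2 : (2 : ℝ) ≤ 2 ^ N := le_self_pow₀ one_le_two hN.ne'
      have h3 : (0 : ℝ) ≤ (2 ^ n) ^ N := by positivity
      rw [pow_succ, mul_pow]
      nlinarith
    have hvol : T * V * 2⁻¹ ≤ volume A := by
      have h1 := measure_sdiff_add_inter (μ := volume)
        (ball (0 : EuclideanSpace ℝ (Fin N)) (2 ^ (n + 1))) (measurableSet_ball (x := 0) (ε := 2 ^ n))
      have h2 : T * V ≤ volume A + T * V * 2⁻¹ := by
        refine (hTV.symm.trans h1.symm).trans_le ?_
        gcongr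
        exact (measure_mono inter_subset_right).trans hhalf
      have h3 : T * V * 2⁻¹ ≠ ∞ :=
        ENNReal.mul_ne_top (ENNReal.mul_ne_top ENNReal.ofReal_ne_top hVt) (by simp)
      refine (ENNReal.add_le_add_iff_right h3).1 (le_trans (le_of_eq ?_) h2)
      rw [← mul_add, ENNReal.inv_two_add_inv_two, mul_one]
    calc V * 2⁻¹ = T⁻¹ * (T * V * 2⁻¹) := by
          rw [← mul_assoc, ← mul_assoc, ENNReal.inv_mul_cancel hT0 ENNReal.ofReal_ne_top, one_mul]
      _ ≤ T⁻¹ * volume A := by gcongr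
      _ = ∫⁻ _ in A, T⁻¹ := (setLIntegral_const _ _).symm
      _ ≤ ∫⁻ x in A, w x := setLIntegral_mono' (measurableSet_ball.diff measurableSet_ball)
          fun x hx => hlow (one_le_pow₀ one_le_two) hx.1
  have hdy (n : ℕ) : n * (V * 2⁻¹) ≤
      ∫⁻ x in ball (0 : EuclideanSpace ℝ (Fin N)) (2 ^ n), w x := by
    induction n with
    | zero => simp
    | succ n ih =>
      have hsub : ball (0 : EuclideanSpace ℝ (Fin N)) (2 ^ n) ⊆ ball 0 (2 ^ (n + 1)) :=
        ball_subset_ball (pow_le_pow_right₀ one_le_two n.le_succ)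
      rw [← union_sdiff_cancel hsub, lintegral_union (measurableSet_ball.diff measurableSet_ball)
        disjoint_sdiff_right]
      push_cast
      rw [add_mul, one_mul]
      exact add_le_add ih (hann n)
  refine ENNReal.tendsto_nhds_top fun m => ?_
  have hc0 : V * 2⁻¹ ≠ 0 := mul_ne_zero hV0 (by simp)
  obtain ⟨n, hn⟩ := ENNReal.exists_nat_mul_gt hc0 (b := m) (by simp)
  filter_upwards [eventually_ge_atTop ((2 : ℝ) ^ n)] with R hR
  exact hn.trans_le ((hdy n).trans (lintegral_mono_set (ball_subset_ball hR)))

end BallAverage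

namespace BallBanachFunctionSpace

/-! ### The quasi-norm of the convexification -/

section ConvexNorm

variable {N : ℕ} (X : BallBanachFunctionSpace N) {p : ℝ}
  {g g₁ g₂ : EuclideanSpace ℝ (Fin N) → ℝ≥0∞}

theorem lnorm_congr (h₁ : AEMeasurable g₁ volume) (h : g₁ =ᵐ[volume] g₂) :
    X.lnorm g₁ = X.lnorm g₂ :=
  le_antisymm (X.lattice _ _ h₁ (h₁.congr h) h.le) (X.lattice _ _ (h₁.congr h) h₁ h.symm.le)

theorem convexNorm_mono (hp : 0 < p) (h₁ : AEMeasurable g₁ volume) (h₂ : AEMeasurable g₂ volume)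
    (h : g₁ ≤ᵐ[volume] g₂) : X.convexNorm p g₁ ≤ X.convexNorm p g₂ := by
  unfold convexNorm
  gcongr
  refine X.lattice _ _ (h₁.pow_const _) (h₂.pow_const _) ?_
  filter_upwards [h] with x hx
  gcongr

theorem convexNorm_const_mul (hp : 0 < p) (hg : AEMeasurable g volume) {c : ℝ≥0∞} (hc : c ≠ ∞) :
    X.convexNorm p (fun x => c * g x) = c * X.convexNorm p g := by
  lift c to ℝ≥0 using hc
  have h : (fun x => ((c : ℝ≥0∞) * g x) ^ (1 / p)) =
      fun x => ((c ^ (1 / p) : ℝ≥0) : ℝ≥0∞) * g x ^ (1 / p) := by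
    ext x
    rw [ENNReal.mul_rpow_of_nonneg _ _ (by positivity),
      ENNReal.coe_rpow_of_nonneg _ (by positivity)]
  rw [convexNorm, convexNorm, h, X.homogeneous _ _ (hg.pow_const _),
    ENNReal.mul_rpow_of_nonneg _ _ hp.le, ← ENNReal.coe_rpow_of_nonneg _ hp.le, ← NNReal.rpow_mul,
    one_div_mul_cancel hp.ne', NNReal.rpow_one]

/-- The quasi-triangle inequality in `X^{1/p}`, with constant close to one in front of the first
term. -/
theorem exists_convexNorm_add_le (hp : 0 < p) {δ : ℝ≥0} (hδ : 0 < δ) :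
    ∃ C : ℝ≥0, ∀ g₁ g₂ : EuclideanSpace ℝ (Fin N) → ℝ≥0∞, AEMeasurable g₁ volume →
      AEMeasurable g₂ volume → X.convexNorm p (fun x => g₁ x + g₂ x) ≤
        (1 + δ) * X.convexNorm p g₁ + C * X.convexNorm p g₂ := by
  -- `1 + δ` is split between the inner power `1/p` and the outer power `p`
  have h1 : (1 : ℝ≥0) < (1 + δ) ^ (1 / 2 : ℝ) :=
    NNReal.one_lt_rpow (by simpa using hδ) (by positivity)
  obtain ⟨δ₁, hδ₁⟩ := exists_add_of_le h1.le
  have hδ₁0 : 0 < δ₁ := by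
    rw [pos_iff_ne_zero]
    rintro rfl
    rw [hδ₁, add_zero] at h1
    exact h1.false
  have hsq : ((1 : ℝ≥0∞) + δ₁) * (1 + δ₁) = 1 + δ := by
    have : (1 + δ₁) * (1 + δ₁) = 1 + δ := by
      rw [← hδ₁, ← NNReal.rpow_add (by positivity)]
      norm_num
    exact_mod_cast this
  have h2 : (1 : ℝ≥0) < (1 + δ₁) ^ (1 / p) :=
    NNReal.one_lt_rpow (by simpa using hδ₁0) (by positivity)
  obtain ⟨δ₂, hδ₂⟩ := exists_add_of_le h2.le
  have hδ₂0 : 0 < δ₂ := by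
    rw [pos_iff_ne_zero]
    rintro rfl
    rw [hδ₂, add_zero] at h2
    exact h2.false
  have hpow : (((1 + δ₂ : ℝ≥0)) : ℝ≥0∞) ^ p = 1 + δ₁ := by
    rw [← hδ₂, ← ENNReal.coe_rpow_of_nonneg _ hp.le, ← NNReal.rpow_mul,
      one_div_mul_cancel hp.ne']
    simp
  obtain ⟨C₁, hC₁⟩ := exists_add_rpow_le hp hδ₁0
  obtain ⟨C₂, hC₂⟩ := exists_add_rpow_le (q := 1 / p) (by positivity) hδ₂0
  refine ⟨C₁ * C₂ ^ p, fun g₁ g₂ hg₁ hg₂ => ?_⟩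
  have hm₁ : AEMeasurable (fun x => g₁ x ^ (1 / p)) volume := hg₁.pow_const _
  have hm₂ : AEMeasurable (fun x => g₂ x ^ (1 / p)) volume := hg₂.pow_const _
  calc X.convexNorm p (fun x => g₁ x + g₂ x)
      ≤ (X.lnorm fun x => ((1 + δ₂ : ℝ≥0) : ℝ≥0∞) * g₁ x ^ (1 / p) +
          (C₂ : ℝ≥0∞) * g₂ x ^ (1 / p)) ^ p := by
        unfold convexNorm
        gcongr
        refine X.lattice _ _ ((hg₁.add hg₂).pow_const _)
          ((hm₁.const_mul _).add (hm₂.const_mul _)) (ae_of_all _ fun x => ?_)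
        exact_mod_cast hC₂ (g₁ x) (g₂ x)
    _ ≤ (((1 + δ₂ : ℝ≥0) : ℝ≥0∞) * X.lnorm (fun x => g₁ x ^ (1 / p)) +
          (C₂ : ℝ≥0∞) * X.lnorm (fun x => g₂ x ^ (1 / p))) ^ p := by
        gcongr
        rw [← X.homogeneous _ _ hm₁, ← X.homogeneous _ _ hm₂]
        exact X.triangle _ _ (hm₁.const_mul _) (hm₂.const_mul _)
    _ ≤ _ := hC₁ _ _
    _ = _ := by
        rw [ENNReal.mul_rpow_of_nonneg _ _ hp.le, ENNReal.mul_rpow_of_nonneg _ _ hp.le, hpow,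
          ← mul_assoc, hsq, ENNReal.coe_mul, ENNReal.coe_rpow_of_nonneg _ hp.le, mul_assoc]
        rfl

theorem convexNorm_zero (hp : 0 < p) : X.convexNorm p (fun _ => 0) = 0 := by
  simpa using X.convexNorm_const_mul hp (g := fun _ => 0) aemeasurable_const ENNReal.zero_ne_top

theorem tendsto_convexNorm_sum (hp : 0 < p) {α ι : Type*} {l : Filter α} (s : Finset ι)
    (u : ι → α → EuclideanSpace ℝ (Fin N) → ℝ≥0∞) (hm : ∀ i a, AEMeasurable (u i a) volume)
    (h : ∀ i ∈ s, Tendsto (fun a => X.convexNorm p (u i a)) l (𝓝 0)) :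
    Tendsto (fun a => X.convexNorm p fun x => ∑ i ∈ s, u i a x) l (𝓝 0) := by
  classical
  induction s using Finset.induction_on with
  | empty => simpa [X.convexNorm_zero hp] using tendsto_const_nhds
  | insert i s hi ih =>
    obtain ⟨C, hC⟩ := X.exists_convexNorm_add_le hp one_pos
    have h1 := ENNReal.Tendsto.const_mul (a := 1 + ((1 : ℝ≥0) : ℝ≥0∞))
      (h i (Finset.mem_insert_self i s)) (Or.inr (by simp))
    have h2 := ENNReal.Tendsto.const_mul (a := (C : ℝ≥0∞))
      (ih fun j hj => h j (Finset.mem_insert_of_mem hj)) (Or.inr (by simp))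
    have h3 := h1.add h2
    rw [mul_zero, mul_zero, add_zero] at h3
    refine tendsto_of_tendsto_of_tendsto_of_le_of_le tendsto_const_nhds h3 (fun _ => zero_le)
      fun a => ?_
    simp only [Finset.sum_insert hi]
    exact hC _ _ (hm i a) (Finset.aemeasurable_fun_sum s fun j _ => hm j a)

theorem convexNorm_indicator_one (hp : 0 < p) (s : Set (EuclideanSpace ℝ (Fin N))) :
    X.convexNorm p (s.indicator 1) = X.lnorm (s.indicator 1) ^ p := by
  rw [convexNorm]
  congr 2
  ext x
  by_cases hx : x ∈ s
  · simp [hx]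
  · simp [hx, hp]

theorem convexNorm_indicator_ball_lt_top (hp : 0 < p) {r : ℝ} (hr : 0 < r) :
    X.convexNorm p ((ball 0 r).indicator 1) < ∞ := by
  rw [X.convexNorm_indicator_one hp]
  exact ENNReal.rpow_lt_top_of_nonneg hp.le (X.ball_mem 0 r hr).ne

/-! ### Decay of averages over large balls -/

/-- Boundedness of the maximal operator on `X^{1/p}` makes `R⁻ᴺ ‖1_{B_R}‖` not only bounded but
null: on `ball 0 R` the mean of `w = M 1_{B_1}` is dominated by `M w`, whose quasi-norm is finite,
while the integral of `w` over `ball 0 R` is unbounded. -/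
theorem tendsto_convexNorm_indicator_ball (hN : 0 < N) (hp : 0 < p) (hM : X.MaximalBounded p) :
    Tendsto (fun R : ℝ => (ENNReal.ofReal (R ^ N))⁻¹ * X.convexNorm p ((ball 0 R).indicator 1))
      atTop (𝓝 0) := by
  obtain ⟨C, hC⟩ := hM
  set w : EuclideanSpace ℝ (Fin N) → ℝ≥0∞ := hlMaximal ((ball 0 1).indicator 1) with hw
  set V := volume (ball (0 : EuclideanSpace ℝ (Fin N)) 1) with hV
  have hVt : V ≠ ∞ := measure_ball_lt_top.ne
  have hwt : X.convexNorm p w < ∞ :=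
    (hC _ (measurable_one.indicator measurableSet_ball).aemeasurable
      (X.convexNorm_indicator_ball_lt_top hp one_pos)).trans_lt
      (ENNReal.mul_lt_top (by simp) (X.convexNorm_indicator_ball_lt_top hp one_pos))
  have hwwt : X.convexNorm p (hlMaximal w) < ∞ :=
    (hC _ (measurable_hlMaximal _).aemeasurable hwt).trans_lt (ENNReal.mul_lt_top (by simp) hwt)
  set K := V * X.convexNorm p (hlMaximal w) with hK
  have hKt : K ≠ ∞ := ENNReal.mul_ne_top hVt hwwt.ne
  have key (c : ℝ≥0) : ∀ᶠ R : ℝ in atTop, (c : ℝ≥0∞) * ((ENNReal.ofReal (R ^ N))⁻¹ *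
      X.convexNorm p ((ball 0 R).indicator 1)) ≤ K := by
    filter_upwards [(tendsto_lintegral_hlMaximal_indicator hN).eventually
      (lt_mem_nhds (ENNReal.coe_lt_top (r := c))), eventually_gt_atTop 0] with R hR hR0
    have hT0 : ENNReal.ofReal (R ^ N) ≠ 0 := by simpa using by positivity
    rw [← mul_assoc, hK, ← X.convexNorm_const_mul hp
      (measurable_one.indicator measurableSet_ball).aemeasurable
      (ENNReal.mul_ne_top ENNReal.coe_ne_top (by simpa using by positivity)),
      ← X.convexNorm_const_mul hp (measurable_hlMaximal _).aemeasurable hVt]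
    refine X.convexNorm_mono hp
      ((measurable_one.indicator measurableSet_ball).const_mul _).aemeasurable
      ((measurable_hlMaximal _).const_mul _).aemeasurable (ae_of_all _ fun x => ?_)
    by_cases hx : x ∈ ball 0 R
    · simp only [indicator_of_mem hx, Pi.one_apply, mul_one]
      have h := setLIntegral_ball_le_mul_hlMaximal w hx
      rw [volume_ball_eq_ofReal_pow_mul _ hR0, ← hV, mul_assoc] at h
      rw [mul_comm]
      calc (ENNReal.ofReal (R ^ N))⁻¹ * c
          ≤ (ENNReal.ofReal (R ^ N))⁻¹ * (ENNReal.ofReal (R ^ N) * (V * hlMaximal w x)) := by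
            gcongr
            exact hR.le.trans h
        _ = _ := by
            rw [← mul_assoc, ENNReal.inv_mul_cancel hT0 ENNReal.ofReal_ne_top, one_mul]
    · simp [indicator_of_notMem hx]
  refine ENNReal.tendsto_nhds_zero.2 fun ε hε => ?_
  -- choose `c` with `K ≤ c ε`
  obtain ⟨n, hn⟩ := ENNReal.exists_nat_mul_gt hε.ne' hKt
  have hn0 : (n : ℝ≥0∞) ≠ 0 := by
    rintro h
    simp [h] at hn
  filter_upwards [key n] with R hR
  have h := hR.trans hn.le
  exact (ENNReal.mul_le_mul_iff_right hn0 (by simp)).1 (by simpa using h)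

theorem exists_convexNorm_ballAverage_le (hp : 0 < p) (hM : X.MaximalBounded p) :
    ∃ C : ℝ≥0, ∀ g : EuclideanSpace ℝ (Fin N) → ℝ≥0∞, Measurable g → X.convexNorm p g < ∞ →
      ∀ ρ : ℝ, 0 < ρ → X.convexNorm p (ballAverage ρ g) ≤ C * X.convexNorm p g := by
  obtain ⟨C, hC⟩ := hM
  have hVt : volume (ball (0 : EuclideanSpace ℝ (Fin N)) 1) ≠ ∞ := measure_ball_lt_top.ne
  lift volume (ball (0 : EuclideanSpace ℝ (Fin N)) 1) to ℝ≥0 using hVt with V hV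
  refine ⟨V * C, fun g hg hgt ρ hρ => ?_⟩
  calc X.convexNorm p (ballAverage ρ g) ≤ X.convexNorm p (fun x => V * hlMaximal g x) :=
        X.convexNorm_mono hp (measurable_ballAverage ρ hg).aemeasurable
          ((measurable_hlMaximal g).const_mul _).aemeasurable
          (ae_of_all _ fun x => by
            rw [hV]
            exact ballAverage_le_mul_hlMaximal hρ g x)
    _ = V * X.convexNorm p (hlMaximal g) :=
        X.convexNorm_const_mul hp (measurable_hlMaximal g).aemeasurable ENNReal.coe_ne_top
    _ ≤ V * (C * X.convexNorm p g) := by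
        gcongr
        exact hC g hg.aemeasurable hgt
    _ = _ := by rw [ENNReal.coe_mul, mul_assoc]

theorem tendsto_convexNorm_ballAverage_of_le_indicator (hN : 0 < N) (hp : 0 < p)
    (hM : X.MaximalBounded p) (hg : Measurable g) {r : ℝ} (hr : 0 < r) {M : ℝ≥0}
    (hgM : g ≤ᵐ[volume] (ball 0 r).indicator fun _ => (M : ℝ≥0∞)) :
    Tendsto (fun ρ => X.convexNorm p (ballAverage ρ g)) atTop (𝓝 0) := by
  set K : ℝ≥0∞ := 2 ^ N * (M * volume (ball (0 : EuclideanSpace ℝ (Fin N)) r)) with hK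
  have hKt : K ≠ ∞ := ENNReal.mul_ne_top (ENNReal.pow_ne_top (by simp))
    (ENNReal.mul_ne_top ENNReal.coe_ne_top measure_ball_lt_top.ne)
  have h1 := ENNReal.Tendsto.const_mul (a := K) ((X.tendsto_convexNorm_indicator_ball hN hp hM).comp
    (tendsto_id.const_mul_atTop (two_pos (α := ℝ)))) (Or.inr hKt)
  rw [mul_zero] at h1
  refine tendsto_of_tendsto_of_tendsto_of_le_of_le' tendsto_const_nhds h1
    (Eventually.of_forall fun _ => zero_le) ?_
  filter_upwards [eventually_ge_atTop r] with ρ hρ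
  have hρ0 : 0 < ρ := hr.trans_le hρ
  have hm : Measurable ((ball (0 : EuclideanSpace ℝ (Fin N)) (2 * ρ)).indicator
    (1 : EuclideanSpace ℝ (Fin N) → ℝ≥0∞)) := measurable_one.indicator measurableSet_ball
  simp only [Function.comp_apply, id]
  rw [← X.convexNorm_const_mul hp hm.aemeasurable (by simpa using by positivity),
    ← X.convexNorm_const_mul hp (hm.const_mul _).aemeasurable hKt]
  exact X.convexNorm_mono hp (measurable_ballAverage ρ hg).aemeasurable
    ((hm.const_mul _).const_mul _).aemeasurable
    (ae_of_all _ fun x => (ballAverage_mono hgM x).trans (ballAverage_indicator_le hr hρ M x))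

/-- For an absolutely continuous norm the averages of every function in `X^{1/p}` tend to zero:
bounded functions of bounded support are dense, and the averaging operators are uniformly
bounded. -/
theorem tendsto_convexNorm_ballAverage_of_absolutelyContinuousNorm (hN : 0 < N) (hp : 0 < p)
    (hM : X.MaximalBounded p) (hX : X.AbsolutelyContinuousNorm) (hg : Measurable g)
    (hgt : ∀ x, g x ≠ ∞) (hgX : X.convexNorm p g < ∞) :
    Tendsto (fun ρ => X.convexNorm p (ballAverage ρ g)) atTop (𝓝 0) := by
  obtain ⟨C, hC⟩ := X.exists_convexNorm_ballAverage_le hp hM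
  obtain ⟨K, hK⟩ := X.exists_convexNorm_add_le hp one_pos
  let S : ℕ → Set (EuclideanSpace ℝ (Fin N)) := fun n => ball 0 (n + 1) ∩ {x | g x ≤ n}
  have hS (n : ℕ) : MeasurableSet (S n) :=
    measurableSet_ball.inter (measurableSet_le hg measurable_const)
  have hlnorm : X.lnorm (fun x => g x ^ (1 / p)) < ∞ := by
    have h := ENNReal.rpow_lt_top_of_nonneg (y := 1 / p) (by positivity) hgX.ne
    rwa [convexNorm, ← ENNReal.rpow_mul, mul_one_div_cancel hp.ne', ENNReal.rpow_one] at h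
  have hev (x : EuclideanSpace ℝ (Fin N)) : ∀ᶠ n : ℕ in atTop, x ∉ (S n)ᶜ := by
    obtain ⟨n₁, hn₁⟩ := ENNReal.exists_nat_gt (hgt x)
    obtain ⟨n₂, hn₂⟩ := exists_nat_gt ‖x‖
    filter_upwards [eventually_ge_atTop n₁, eventually_ge_atTop n₂] with n h1 h2
    have h1' : (n₁ : ℝ≥0∞) ≤ n := by exact_mod_cast h1
    have h2' : (n₂ : ℝ) ≤ n := by exact_mod_cast h2
    rw [notMem_compl_iff]
    refine ⟨?_, hn₁.le.trans h1'⟩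
    rw [mem_ball_zero_iff]
    linarith
  have htail : Tendsto (fun n => X.convexNorm p ((S n)ᶜ.indicator g)) atTop (𝓝 0) := by
    have h := (hX _ (hg.pow_const (1 / p)).aemeasurable hlnorm (fun n => (S n)ᶜ)
      (fun n => (hS n).compl) (ae_of_all _ hev)).ennrpow_const p
    rw [ENNReal.zero_rpow_of_pos hp] at h
    refine h.congr fun n => ?_
    rw [convexNorm]
    congr 2
    ext x
    by_cases hx : x ∈ (S n)ᶜ
    · simp only [indicator_of_mem hx]
    · simp only [indicator_of_notMem hx]
      rw [ENNReal.zero_rpow_of_pos (by positivity)]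
  have hmain (n : ℕ) : Tendsto (fun ρ => X.convexNorm p (ballAverage ρ ((S n).indicator g)))
      atTop (𝓝 0) := by
    refine X.tendsto_convexNorm_ballAverage_of_le_indicator hN hp hM (hg.indicator (hS n))
      (r := n + 1) (by positivity) (M := n) (ae_of_all _ fun x => ?_)
    by_cases hx : x ∈ S n
    · rw [indicator_of_mem hx, indicator_of_mem hx.1]
      exact_mod_cast hx.2
    · rw [indicator_of_notMem hx]
      exact zero_le
  have hbound (n : ℕ) {ρ : ℝ} (hρ : 0 < ρ) : X.convexNorm p (ballAverage ρ g) ≤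
      (1 + (1 : ℝ≥0)) * X.convexNorm p (ballAverage ρ ((S n).indicator g)) +
        K * (C * X.convexNorm p ((S n)ᶜ.indicator g)) := by
    have hi : Measurable ((S n).indicator g) := hg.indicator (hS n)
    have hi' : Measurable ((S n)ᶜ.indicator g) := hg.indicator (hS n).compl
    have hsplit : ballAverage ρ g =
        fun x => ballAverage ρ ((S n).indicator g) x + ballAverage ρ ((S n)ᶜ.indicator g) x := by
      ext x
      rw [← ballAverage_add hi]
      congr 1
      ext y
      exact (congrFun (indicator_self_add_compl (S n) g) y).symm
    rw [hsplit]
    refine (hK _ _ (measurable_ballAverage ρ hi).aemeasurable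
      (measurable_ballAverage ρ hi').aemeasurable).trans ?_
    gcongr
    refine hC _ hi' (lt_of_le_of_lt ?_ hgX) ρ hρ
    exact X.convexNorm_mono hp hi'.aemeasurable hg.aemeasurable
      (ae_of_all _ fun x => indicator_le_self _ _ x)
  refine ENNReal.tendsto_nhds_zero.2 fun ε hε => ?_
  have h1 : Tendsto (fun n => (K : ℝ≥0∞) * (C * X.convexNorm p ((S n)ᶜ.indicator g))) atTop
      (𝓝 0) := by
    simpa using ENNReal.Tendsto.const_mul (a := (K : ℝ≥0∞))
      (ENNReal.Tendsto.const_mul (a := (C : ℝ≥0∞)) htail (Or.inr (by simp))) (Or.inr (by simp))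
  obtain ⟨n, hn⟩ := (h1.eventually (gt_mem_nhds (ENNReal.half_pos hε.ne'))).exists
  have h2 : Tendsto (fun ρ => (1 + ((1 : ℝ≥0) : ℝ≥0∞)) *
      X.convexNorm p (ballAverage ρ ((S n).indicator g))) atTop (𝓝 0) := by
    simpa using ENNReal.Tendsto.const_mul (a := 1 + ((1 : ℝ≥0) : ℝ≥0∞)) (hmain n)
      (Or.inr (by simp))
  filter_upwards [h2.eventually (gt_mem_nhds (ENNReal.half_pos hε.ne')), eventually_gt_atTop 0]
    with ρ hρ hρ0
  refine (hbound n hρ0).trans ?_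
  rw [← ENNReal.add_halves ε]
  exact add_le_add hρ.le hn.le

end ConvexNorm

end BallBanachFunctionSpace

/-! ### Averaged differences -/

section Differences

variable {N : ℕ} {𝕜 : Type*} [RCLike 𝕜]

/-- Up to factors close to one, the `k`-th difference at `x` is `f x` plus an error controlled by
the values of `f` at the other points `x + j h`. -/
theorem exists_enorm_fwdDiff_iter_rpow_le (E : Type*) [AddCommGroup E] {p : ℝ} (hp : 0 < p)
    (k : ℕ) {δ : ℝ≥0} (hδ : 0 < δ) :
    ∃ C : ℝ≥0, ∀ (f : E → 𝕜) (x h : E),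
      ‖((fwdDiff h)^[k] f) x‖ₑ ^ p ≤
        (1 + δ) * ‖f x‖ₑ ^ p + C * ∑ j ∈ Finset.Icc 1 k, ‖f (x + j • h)‖ₑ ^ p ∧
      ‖f x‖ₑ ^ p ≤ (1 + δ) * ‖((fwdDiff h)^[k] f) x‖ₑ ^ p +
        C * ∑ j ∈ Finset.Icc 1 k, ‖f (x + j • h)‖ₑ ^ p := by
  obtain ⟨C, hC⟩ := exists_add_rpow_le hp hδ
  let c : ℕ → 𝕜 := fun j => (((-1 : ℤ) ^ (k - j) * k.choose j : ℤ) : 𝕜)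
  refine ⟨C * ((k : ℝ≥0) ^ p * ∑ j ∈ Finset.Icc 1 k, ‖c j‖₊ ^ p), fun f x h => ?_⟩
  set r : 𝕜 := ∑ j ∈ Finset.Icc 1 k, c j * f (x + j • h) with hr
  have hsplit : ((fwdDiff h)^[k] f) x = (-1) ^ k * f x + r := by
    rw [fwdDiff_iter_eq_sum_shift, Finset.range_eq_Ico, Finset.sum_eq_sum_Ico_succ_bot (by omega)]
    simp only [zsmul_eq_mul]
    congr 1
    simp
  have hrle : ‖r‖ₑ ^ p ≤ (((k : ℝ≥0) ^ p * ∑ j ∈ Finset.Icc 1 k, ‖c j‖₊ ^ p : ℝ≥0) : ℝ≥0∞) *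
      ∑ j ∈ Finset.Icc 1 k, ‖f (x + j • h)‖ₑ ^ p := by
    calc ‖r‖ₑ ^ p ≤ (∑ j ∈ Finset.Icc 1 k, ‖c j * f (x + j • h)‖ₑ) ^ p := by
          gcongr
          exact enorm_sum_le _ _
      _ ≤ _ := sum_rpow_le_card_rpow_mul_sum _ hp _
      _ ≤ _ := by
          rw [ENNReal.coe_mul, mul_assoc, ENNReal.coe_rpow_of_nonneg _ hp.le,
            ENNReal.ofNNReal_finsetSum,
            Finset.mul_sum (Finset.Icc 1 k) (fun j => ‖f (x + j • h)‖ₑ ^ p)]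
          simp only [Nat.card_Icc, Nat.add_sub_cancel, ENNReal.coe_natCast]
          gcongr with j hj
          rw [enorm_mul, ENNReal.mul_rpow_of_nonneg _ _ hp.le]
          gcongr
          rw [enorm_eq_nnnorm, ← ENNReal.coe_rpow_of_nonneg _ hp.le]
          exact Finset.single_le_sum (f := fun j => ((‖c j‖₊ ^ p : ℝ≥0) : ℝ≥0∞))
            (fun _ _ => zero_le) hj
  have hone : ‖(-1 : 𝕜) ^ k * f x‖ₑ = ‖f x‖ₑ := by
    rw [enorm_mul, enorm_pow, enorm_neg, enorm_one, one_pow, one_mul]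
  rw [ENNReal.coe_mul, mul_assoc]
  constructor
  · calc ‖((fwdDiff h)^[k] f) x‖ₑ ^ p ≤ (‖f x‖ₑ + ‖r‖ₑ) ^ p := by
          gcongr
          rw [hsplit, ← hone]
          exact enorm_add_le _ _
      _ ≤ _ := hC _ _
      _ ≤ _ := by gcongr
  · calc ‖f x‖ₑ ^ p ≤ (‖((fwdDiff h)^[k] f) x‖ₑ + ‖r‖ₑ) ^ p := by
          gcongr
          rw [← hone, eq_sub_of_add_eq hsplit.symm]
          exact enorm_sub_le
      _ ≤ _ := hC _ _
      _ ≤ _ := by gcongr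

/-- The mean `R⁻ᴺ ∫_{|h| ≤ R} |Δ_h^k f(x)|^p dh`. -/
noncomputable def diffAverage (p : ℝ) (k : ℕ) (f : EuclideanSpace ℝ (Fin N) → 𝕜) (R : ℝ)
    (x : EuclideanSpace ℝ (Fin N)) : ℝ≥0∞ :=
  (∫⁻ h in closedBall (0 : EuclideanSpace ℝ (Fin N)) R, ‖((fwdDiff h)^[k] f) x‖ₑ ^ p) /
    ENNReal.ofReal (R ^ N)

theorem measurable_enorm_fwdDiff_iter (p : ℝ) (k : ℕ) {f : EuclideanSpace ℝ (Fin N) → 𝕜}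
    (hf : Measurable f) :
    Measurable fun z : EuclideanSpace ℝ (Fin N) × EuclideanSpace ℝ (Fin N) =>
      ‖((fwdDiff z.2)^[k] f) z.1‖ₑ ^ p := by
  simp only [fwdDiff_iter_eq_sum_shift, zsmul_eq_mul]
  refine Measurable.pow_const (Measurable.enorm ?_) _
  refine Finset.measurable_fun_sum _ fun j _ => measurable_const.mul (hf.comp ?_)
  exact measurable_fst.add (measurable_snd.const_smul j)

theorem measurable_diffAverage (p : ℝ) (k : ℕ) {f : EuclideanSpace ℝ (Fin N) → 𝕜}
    (hf : Measurable f) (R : ℝ) : Measurable (diffAverage p k f R) :=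
  (Measurable.lintegral_prod_right (measurable_enorm_fwdDiff_iter p k hf)).div_const _

/-- Averaging `g (x + j h)` over `|h| ≤ R` amounts to averaging `g` over `closedBall x (j R)`. -/
theorem setLIntegral_comp_add_nsmul {g : EuclideanSpace ℝ (Fin N) → ℝ≥0∞} (hg : Measurable g)
    {j : ℕ} (hj : 0 < j) (R : ℝ) (x : EuclideanSpace ℝ (Fin N)) :
    (∫⁻ h in closedBall (0 : EuclideanSpace ℝ (Fin N)) R, g (x + j • h)) /
      ENNReal.ofReal (R ^ N) = ballAverage (j * R) g x := by
  have hj' : (0 : ℝ) < j := by exact_mod_cast hj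
  have h1 : ∫⁻ y in closedBall x (j * R), g y =
      ∫⁻ y in closedBall 0 (j * R), g (x + y) := by
    rw [← (measurePreserving_add_left volume x).setLIntegral_comp_preimage
      measurableSet_closedBall hg]
    simp
  have h2 : ∫⁻ h in closedBall (0 : EuclideanSpace ℝ (Fin N)) R, g (x + j • h) =
      ENNReal.ofReal ((j : ℝ) ^ N)⁻¹ * ∫⁻ y in closedBall 0 (j * R), g (x + y) := by
    have hmap := Measure.map_addHaar_smul (volume : Measure (EuclideanSpace ℝ (Fin N))) hj'.ne'
    have h3 := setLIntegral_map (μ := volume) (measurableSet_closedBall (x := 0) (ε := j * R))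
      (hg.comp (measurable_const_add x)) (measurable_const_smul (j : ℝ))
    rw [hmap, Measure.restrict_smul, lintegral_smul_measure, finrank_euclideanSpace_fin,
      abs_of_pos (by positivity)] at h3
    simp only [Function.comp_apply, smul_eq_mul] at h3
    rw [h3]
    have hpre : ((j : ℝ) • · : EuclideanSpace ℝ (Fin N) → EuclideanSpace ℝ (Fin N)) ⁻¹'
        closedBall 0 (j * R) = closedBall 0 R := by
      ext h
      simp [norm_smul, hj']
    rw [hpre]
    simp only [Nat.cast_smul_eq_nsmul]
  rw [ballAverage, h1, h2, mul_pow, ENNReal.ofReal_mul (by positivity), div_eq_mul_inv,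
    div_eq_mul_inv,
    ENNReal.mul_inv (Or.inl (ENNReal.ofReal_pos.2 (by positivity)).ne') (Or.inl (by simp)),
    ENNReal.ofReal_inv_of_pos (by positivity)]
  ring

/-- The averaged form of the two-sided comparison: the mean of `|Δ_h^k f(x)|^p` agrees with
`|B_1| |f(x)|^p` up to averages of `|f|^p` over the balls of radii `R, …, k R` about `x`. -/
theorem exists_diffAverage_le {p : ℝ} (hp : 0 < p) (k : ℕ) {δ : ℝ≥0} (hδ : 0 < δ) :
    ∃ C : ℝ≥0, ∀ f : EuclideanSpace ℝ (Fin N) → 𝕜, Measurable f → ∀ R : ℝ, 0 < R → ∀ x,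
      diffAverage p k f R x ≤
        (1 + δ) * (volume (ball (0 : EuclideanSpace ℝ (Fin N)) 1) * ‖f x‖ₑ ^ p) +
          C * ∑ j ∈ Finset.Icc 1 k, ballAverage (j * R) (fun y => ‖f y‖ₑ ^ p) x ∧
      volume (ball (0 : EuclideanSpace ℝ (Fin N)) 1) * ‖f x‖ₑ ^ p ≤
        (1 + δ) * diffAverage p k f R x +
          C * ∑ j ∈ Finset.Icc 1 k, ballAverage (j * R) (fun y => ‖f y‖ₑ ^ p) x := by
  obtain ⟨C, hC⟩ := exists_enorm_fwdDiff_iter_rpow_le (𝕜 := 𝕜) (EuclideanSpace ℝ (Fin N)) hp k hδ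
  refine ⟨C, fun f hf R hR x => ?_⟩
  have hT0 : ENNReal.ofReal (R ^ N) ≠ 0 := by simpa using by positivity
  have hg : Measurable fun y => ‖f y‖ₑ ^ p := hf.enorm.pow_const p
  set B := closedBall (0 : EuclideanSpace ℝ (Fin N)) R with hB
  have hshift (j : ℕ) : Measurable fun h : EuclideanSpace ℝ (Fin N) => ‖f (x + j • h)‖ₑ ^ p :=
    hg.comp (measurable_const.add (measurable_id.const_smul j))
  have hsum : (∫⁻ h in B, C * ∑ j ∈ Finset.Icc 1 k, ‖f (x + j • h)‖ₑ ^ p) /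
      ENNReal.ofReal (R ^ N) =
      C * ∑ j ∈ Finset.Icc 1 k, ballAverage (j * R) (fun y => ‖f y‖ₑ ^ p) x := by
    rw [lintegral_const_mul' _ _ ENNReal.coe_ne_top, lintegral_finsetSum _ fun j _ => hshift j,
      mul_div_assoc, div_eq_mul_inv, Finset.sum_mul]
    congr 1
    refine Finset.sum_congr rfl fun j hj => ?_
    rw [← div_eq_mul_inv]
    exact setLIntegral_comp_add_nsmul hg (Finset.mem_Icc.1 hj).1 R x
  have hconst (c : ℝ≥0∞) : (∫⁻ _ in B, c) / ENNReal.ofReal (R ^ N) =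
      volume (ball (0 : EuclideanSpace ℝ (Fin N)) 1) * c := by
    rw [setLIntegral_const, hB, Measure.addHaar_closedBall volume _ hR.le,
      finrank_euclideanSpace_fin, div_eq_mul_inv]
    calc _ = (ENNReal.ofReal (R ^ N) * (ENNReal.ofReal (R ^ N))⁻¹) *
          (volume (ball (0 : EuclideanSpace ℝ (Fin N)) 1) * c) := by ring
      _ = _ := by rw [ENNReal.mul_inv_cancel hT0 ENNReal.ofReal_ne_top, one_mul]
  have hd : Measurable fun h => ‖((fwdDiff h)^[k] f) x‖ₑ ^ p := by
    have h := (measurable_enorm_fwdDiff_iter p k hf).comp (measurable_prodMk_left (x := x))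
    exact h
  constructor
  · calc diffAverage p k f R x
        ≤ (∫⁻ h in B, ((1 + δ) * ‖f x‖ₑ ^ p +
            C * ∑ j ∈ Finset.Icc 1 k, ‖f (x + j • h)‖ₑ ^ p)) / ENNReal.ofReal (R ^ N) :=
          ENNReal.div_le_div_right (lintegral_mono fun h => (hC f x h).1) _
      _ = _ := by
          rw [lintegral_add_left measurable_const, ENNReal.add_div, hsum, hconst]
          ring
  · calc volume (ball (0 : EuclideanSpace ℝ (Fin N)) 1) * ‖f x‖ₑ ^ p
        = (∫⁻ _ in B, ‖f x‖ₑ ^ p) / ENNReal.ofReal (R ^ N) := (hconst _).symm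
      _ ≤ (∫⁻ h in B, ((1 + δ) * ‖((fwdDiff h)^[k] f) x‖ₑ ^ p +
            C * ∑ j ∈ Finset.Icc 1 k, ‖f (x + j • h)‖ₑ ^ p)) / ENNReal.ofReal (R ^ N) :=
          ENNReal.div_le_div_right (lintegral_mono fun h => (hC f x h).2) _
      _ = _ := by
          rw [lintegral_add_left (hd.const_mul _), ENNReal.add_div, hsum,
            lintegral_const_mul' _ _ (by simp), mul_div_assoc, diffAverage]

/-- Modifying `f` on a null set changes its averaged differences only on a null set. -/
theorem diffAverage_ae_congr (p : ℝ) (k : ℕ) {f f' : EuclideanSpace ℝ (Fin N) → 𝕜}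
    (h : f =ᵐ[volume] f') (R : ℝ) : diffAverage p k f R =ᵐ[volume] diffAverage p k f' R := by
  filter_upwards [h] with x hx
  rw [diffAverage, diffAverage]
  congr 1
  refine lintegral_congr_ae (ae_restrict_of_ae ?_)
  have hj (j : ℕ) : ∀ᵐ y : EuclideanSpace ℝ (Fin N), f (x + j • y) = f' (x + j • y) := by
    rcases Nat.eq_zero_or_pos j with rfl | hj
    · simpa using hx
    · have hj' : (j : ℝ) ≠ 0 := by exact_mod_cast hj.ne'
      have h1 : Measure.QuasiMeasurePreserving
          (fun y : EuclideanSpace ℝ (Fin N) => (j : ℝ) • y) volume volume := by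
        refine ⟨measurable_const_smul _, ?_⟩
        rw [Measure.map_addHaar_smul volume hj']
        exact Measure.smul_absolutelyContinuous
      have h2 := ((measurePreserving_add_left volume x).quasiMeasurePreserving.comp h1).ae_eq_comp h
      filter_upwards [h2] with y hy
      simpa only [Nat.cast_smul_eq_nsmul, Function.comp_apply] using hy
  filter_upwards [ae_all_iff.2 hj] with y hy
  simp only [fwdDiff_iter_eq_sum_shift, hy]

end Differences

namespace BallBanachFunctionSpace

variable {N : ℕ} {𝕜 : Type*} [RCLike 𝕜] (X : BallBanachFunctionSpace N) {p : ℝ} {k : ℕ}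
  {f f' : EuclideanSpace ℝ (Fin N) → 𝕜}

theorem avgDiff_eq_diffAverage_rpow (p : ℝ) (k : ℕ) (f : EuclideanSpace ℝ (Fin N) → 𝕜) {t : ℝ}
    (ht : 0 < t) : avgDiff p k f t = fun x => diffAverage p k f (t ^ (1 / (k : ℝ))) x ^ (1 / p) := by
  ext x
  rw [avgDiff, diffAverage, ← Real.rpow_natCast, ← Real.rpow_mul ht.le, one_div_mul_eq_div]

theorem avgDiffFunctional_eq (p : ℝ) (k : ℕ) (f : EuclideanSpace ℝ (Fin N) → 𝕜) (w : ℝ → ℝ) :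
    X.avgDiffFunctional p k f w = ∫⁻ t in Ioi (0 : ℝ),
      X.convexNorm p (diffAverage p k f (t ^ (1 / (k : ℝ)))) * ENNReal.ofReal (w t) := by
  refine setLIntegral_congr_fun measurableSet_Ioi fun t ht => ?_
  simp only [convexNorm, avgDiff_eq_diffAverage_rpow p k f ht]

theorem convexNorm_enorm_rpow (hp : 0 < p) (f : EuclideanSpace ℝ (Fin N) → 𝕜) :
    X.convexNorm p (fun x => ‖f x‖ₑ ^ p) = X.fnorm f ^ p := by
  simp only [convexNorm, fnorm, ← ENNReal.rpow_mul, mul_one_div_cancel hp.ne', ENNReal.rpow_one]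

theorem fnorm_congr (hf : AEMeasurable f volume) (h : f =ᵐ[volume] f') :
    X.fnorm f = X.fnorm f' :=
  X.lnorm_congr hf.enorm (h.fun_comp fun z => ‖z‖ₑ)

theorem avgDiffFunctional_congr (hf' : Measurable f') (h : f =ᵐ[volume] f') (w : ℝ → ℝ) :
    X.avgDiffFunctional p k f w = X.avgDiffFunctional p k f' w := by
  rw [avgDiffFunctional_eq, avgDiffFunctional_eq]
  refine lintegral_congr fun t => ?_
  unfold convexNorm
  congr 2
  refine (X.lnorm_congr ((measurable_diffAverage p k hf' _).pow_const _).aemeasurable ?_).symm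
  filter_upwards [diffAverage_ae_congr p k h (t ^ (1 / (k : ℝ)))] with x hx
  rw [hx]

/-- If the means of `|f|^p` over balls of radius `ρ` vanish in `X^{1/p}` as `ρ → ∞`, then so does
the contribution of the shifted points to the averaged differences, and the limit formula
holds. -/
theorem tendsto_avgDiffFunctional_of_tendsto_ballAverage (hp : 0 < p) (hk : 0 < k)
    {ψ : ℝ → ℝ → ℝ} (hψ : ConcentratesAtInfinity ψ) (hM : X.MaximalBounded p) (hf : Measurable f)
    (hfX : X.fnorm f < ∞)
    (hA : Tendsto (fun ρ => X.convexNorm p (ballAverage ρ fun y => ‖f y‖ₑ ^ p)) atTop (𝓝 0)) :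
    Tendsto (fun ε => X.avgDiffFunctional p k f (ψ ε)) (𝓝[>] 0)
      (𝓝 (volume (ball (0 : EuclideanSpace ℝ (Fin N)) 1) * X.fnorm f ^ p)) := by
  set V := volume (ball (0 : EuclideanSpace ℝ (Fin N)) 1) with hV
  have hVt : V ≠ ∞ := measure_ball_lt_top.ne
  set g : EuclideanSpace ℝ (Fin N) → ℝ≥0∞ := fun y => ‖f y‖ₑ ^ p with hg
  have hgm : Measurable g := hf.enorm.pow_const p
  have hgX : X.convexNorm p g < ∞ := by
    rw [hg, X.convexNorm_enorm_rpow hp]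
    exact ENNReal.rpow_lt_top_of_nonneg hp.le hfX.ne
  have hLeq : X.convexNorm p (fun x => V * g x) = V * X.fnorm f ^ p := by
    rw [X.convexNorm_const_mul hp hgm.aemeasurable hVt, hg, X.convexNorm_enorm_rpow hp]
  set L := X.convexNorm p (fun x => V * g x) with hL
  have hLt : L ≠ ∞ := by
    rw [hL, X.convexNorm_const_mul hp hgm.aemeasurable hVt]
    exact ENNReal.mul_ne_top hVt hgX.ne
  let E : ℝ → EuclideanSpace ℝ (Fin N) → ℝ≥0∞ :=
    fun R x => ∑ j ∈ Finset.Icc 1 k, ballAverage (j * R) g x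
  have hEm (R : ℝ) : Measurable (E R) :=
    Finset.measurable_fun_sum _ fun j _ => measurable_ballAverage _ hgm
  have hE : Tendsto (fun R => X.convexNorm p (E R)) atTop (𝓝 0) := by
    refine X.tendsto_convexNorm_sum hp (Finset.Icc 1 k) (fun j R => ballAverage (j * R) g)
      (fun j R => (measurable_ballAverage _ hgm).aemeasurable) fun j hj => ?_
    have hj0 : (0 : ℝ) < j := by exact_mod_cast (Finset.mem_Icc.1 hj).1
    exact hA.comp (tendsto_id.const_mul_atTop hj0)
  have hEb : ∃ K : ℝ≥0∞, K ≠ ∞ ∧ ∀ R, 0 < R → X.convexNorm p (E R) ≤ K := by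
    obtain ⟨C, hC⟩ := hM
    have hMX : X.convexNorm p (hlMaximal g) < ∞ :=
      (hC g hgm.aemeasurable hgX).trans_lt (ENNReal.mul_lt_top (by simp) hgX)
    have hkV : (k : ℝ≥0∞) * V ≠ ∞ := ENNReal.mul_ne_top (by simp) hVt
    refine ⟨k * V * X.convexNorm p (hlMaximal g), ENNReal.mul_ne_top hkV hMX.ne, fun R hR => ?_⟩
    rw [← X.convexNorm_const_mul hp (measurable_hlMaximal g).aemeasurable hkV]
    refine X.convexNorm_mono hp (hEm R).aemeasurable
      ((measurable_hlMaximal g).const_mul _).aemeasurable (ae_of_all _ fun x => ?_)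
    calc E R x ≤ (Finset.Icc 1 k).card • (V * hlMaximal g x) :=
          Finset.sum_le_card_nsmul _ _ _ fun j hj => ballAverage_le_mul_hlMaximal
            (mul_pos (by exact_mod_cast (Finset.mem_Icc.1 hj).1) hR) g x
      _ = _ := by simp [mul_assoc]
  -- the two-sided comparison of quasi-norms, with constants close to one
  have hcmp (δ : ℝ≥0) (hδ : 0 < δ) : ∃ C : ℝ≥0, ∀ R, 0 < R →
      X.convexNorm p (diffAverage p k f R) ≤ (1 + δ) * L + C * X.convexNorm p (E R) ∧
      L ≤ (1 + δ) * X.convexNorm p (diffAverage p k f R) + C * X.convexNorm p (E R) := by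
    have hlt : (1 : ℝ≥0∞) < 1 + δ := by exact_mod_cast (lt_add_of_pos_right (1 : ℝ≥0) hδ)
    obtain ⟨η, hη, hη1⟩ := exists_one_add_mul_lt hlt
    rw [mul_one] at hη1
    obtain ⟨θ, hθ, hθ1⟩ := exists_one_add_mul_lt hη1
    obtain ⟨C₁, hC₁⟩ := exists_diffAverage_le (N := N) (𝕜 := 𝕜) hp k hη
    obtain ⟨C₂, hC₂⟩ := X.exists_convexNorm_add_le hp hθ
    refine ⟨C₂ * C₁, fun R hR => ?_⟩
    have hD : Measurable (diffAverage p k f R) := measurable_diffAverage p k hf R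
    have aux {u v : EuclideanSpace ℝ (Fin N) → ℝ≥0∞} (hu : Measurable u) (hv : Measurable v)
        (huv : ∀ x, u x ≤ (1 + η) * v x + C₁ * E R x) : X.convexNorm p u ≤
          (1 + δ) * X.convexNorm p v + (C₂ * C₁ : ℝ≥0) * X.convexNorm p (E R) := by
      calc X.convexNorm p u ≤ X.convexNorm p (fun x => (1 + η) * v x + C₁ * E R x) :=
            X.convexNorm_mono hp hu.aemeasurable
              ((hv.const_mul _).add ((hEm R).const_mul _)).aemeasurable (ae_of_all _ huv)
        _ ≤ _ := hC₂ _ _ (hv.const_mul _).aemeasurable ((hEm R).const_mul _).aemeasurable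
        _ = (1 + θ) * (1 + η) * X.convexNorm p v + (C₂ * C₁ : ℝ≥0) * X.convexNorm p (E R) := by
            rw [X.convexNorm_const_mul hp hv.aemeasurable (by simp),
              X.convexNorm_const_mul hp (hEm R).aemeasurable (by simp), ENNReal.coe_mul]
            ring
        _ ≤ _ := by gcongr
    exact ⟨aux hD (hgm.const_mul V) fun x => (hC₁ f hf R hR x).1,
      aux (hgm.const_mul V) hD fun x => (hC₁ f hf R hR x).2⟩
  have hlim : Tendsto (fun R => X.convexNorm p (diffAverage p k f R)) atTop (𝓝 L) := by
    refine tendsto_of_forall_le_one_add_mul hE fun δ hδ => ?_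
    obtain ⟨C, hC⟩ := hcmp δ hδ
    exact ⟨C, (eventually_gt_atTop 0).mono hC⟩
  obtain ⟨K, hKt, hK⟩ := hEb
  obtain ⟨C, hC⟩ := hcmp 1 one_pos
  rw [← hLeq]
  simp only [avgDiffFunctional_eq]
  refine hψ.tendsto_lintegral_mul (K := (1 + (1 : ℝ≥0)) * L + C * K) ?_ (fun t ht => ?_)
    (hlim.comp (tendsto_rpow_atTop (by positivity)))
  · exact ENNReal.add_ne_top.2 ⟨ENNReal.mul_ne_top (by simp) hLt,
      ENNReal.mul_ne_top (by simp) hKt⟩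
  · have hR : 0 < t ^ (1 / (k : ℝ)) := Real.rpow_pos_of_pos ht _
    refine (hC _ hR).1.trans ?_
    gcongr
    exact hK _ hR

end BallBanachFunctionSpace

theorem MemLinftyCompact.exists_ae_le_indicator {N : ℕ} {𝕜 : Type*} [RCLike 𝕜]
    {f : EuclideanSpace ℝ (Fin N) → 𝕜} (hf : MemLinftyCompact f) :
    ∃ (r : ℝ) (M : ℝ≥0), 0 < r ∧
      (fun x => ‖f x‖ₑ) ≤ᵐ[volume] (ball 0 r).indicator fun _ => (M : ℝ≥0∞) := by
  obtain ⟨hf, K, hK, hfK⟩ := hf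
  obtain ⟨r, hr, hKr⟩ := hK.isBounded.subset_ball_lt 0 0
  refine ⟨r, (eLpNorm f ∞ volume).toNNReal, hr, ?_⟩
  rw [ENNReal.coe_toNNReal hf.2.ne, eLpNorm_exponent_top]
  filter_upwards [hfK, enorm_ae_le_eLpNormEssSup f volume] with x h1 h2
  by_cases hx : x ∈ ball 0 r
  · rwa [indicator_of_mem hx]
  · simp [h1 fun h => hx (hKr h)]

theorem toSphere_real_univ_div_eq_volume_ball {N : ℕ} (hN : 0 < N) :
    ENNReal.ofReal
      ((volume : Measure (EuclideanSpace ℝ (Fin N))).toSphere.real univ / (N : ℝ)) =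
      volume (ball (0 : EuclideanSpace ℝ (Fin N)) 1) := by
  have hN' : (N : ℝ) ≠ 0 := by exact_mod_cast hN.ne'
  rw [Measure.toSphere_real_apply_univ, finrank_euclideanSpace_fin, mul_div_cancel_left₀ _ hN',
    ofReal_measureReal measure_ball_lt_top.ne]

theorem mainTheorem11 {𝕜 : Type*} [RCLike 𝕜] {N : ℕ} (hN : 0 < N)
    (p : ℝ) (hp : 0 < p) (k : ℕ) (hk : 0 < k)
    (X : BallBanachFunctionSpace N)
    (ψ : ℝ → ℝ → ℝ) (hψ : ConcentratesAtInfinity ψ)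
    (hM : X.MaximalBounded p) :
    (∀ f : EuclideanSpace ℝ (Fin N) → 𝕜, MemLinftyCompact f →
      Tendsto (fun ε => X.avgDiffFunctional p k f (ψ ε)) (𝓝[>] 0)
        (𝓝 (ENNReal.ofReal
          ((volume : Measure (EuclideanSpace ℝ (Fin N))).toSphere.real univ / (N : ℝ)) *
            X.fnorm f ^ p))) ∧
    (X.AbsolutelyContinuousNorm →
      ∀ f : EuclideanSpace ℝ (Fin N) → 𝕜, X.Mem f →
        Tendsto (fun ε => X.avgDiffFunctional p k f (ψ ε)) (𝓝[>] 0)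
          (𝓝 (ENNReal.ofReal
            ((volume : Measure (EuclideanSpace ℝ (Fin N))).toSphere.real univ / (N : ℝ)) *
              X.fnorm f ^ p))) := by
  rw [toSphere_real_univ_div_eq_volume_ball hN]
  refine ⟨fun f hf => ?_, fun hX f hf => ?_⟩
  · obtain ⟨r, M, hr, hfM⟩ := hf.exists_ae_le_indicator
    -- neither side of the formula changes under passage to a measurable representative
    obtain ⟨f', hf', hff'⟩ := hf.1.1
    have hf'm := hf'.measurable
    rw [X.fnorm_congr hf.1.1.aemeasurable hff']
    simp only [X.avgDiffFunctional_congr hf'm hff']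
    have hf'M : (fun x => ‖f' x‖ₑ) ≤ᵐ[volume] (ball 0 r).indicator fun _ => (M : ℝ≥0∞) := by
      filter_upwards [hfM, hff'] with x h1 h2
      rwa [← h2]
    have hind : Measurable ((ball (0 : EuclideanSpace ℝ (Fin N)) r).indicator
        (1 : EuclideanSpace ℝ (Fin N) → ℝ≥0∞)) := measurable_one.indicator measurableSet_ball
    have hfX : X.fnorm f' < ∞ := by
      refine lt_of_le_of_lt (X.lattice _ (fun x => M * (ball 0 r).indicator 1 x)
        hf'm.enorm.aemeasurable (hind.const_mul _).aemeasurable ?_) ?_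
      · filter_upwards [hf'M] with x hx
        refine hx.trans_eq ?_
        by_cases h : x ∈ ball 0 r <;> simp [h]
      · rw [X.homogeneous _ _ hind.aemeasurable]
        exact ENNReal.mul_lt_top (by simp) (X.ball_mem 0 r hr)
    refine X.tendsto_avgDiffFunctional_of_tendsto_ballAverage hp hk hψ hM hf'm hfX ?_
    refine X.tendsto_convexNorm_ballAverage_of_le_indicator hN hp hM (hf'm.enorm.pow_const p) hr
      (M := M ^ p) ?_
    filter_upwards [hf'M] with x hx
    by_cases h : x ∈ ball 0 r
    · rw [indicator_of_mem h] at hx ⊢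
      rw [ENNReal.coe_rpow_of_nonneg _ hp.le]
      gcongr
    · rw [indicator_of_notMem h] at hx ⊢
      rw [le_zero_iff.1 hx, ENNReal.zero_rpow_of_pos hp]
  · obtain ⟨f', hf', hff'⟩ := hf.1
    have hf'm := hf'.measurable
    have hfX := hf.2
    rw [X.fnorm_congr hf.1.aemeasurable hff'] at hfX ⊢
    simp only [X.avgDiffFunctional_congr hf'm hff']
    refine X.tendsto_avgDiffFunctional_of_tendsto_ballAverage hp hk hψ hM hf'm hfX ?_
    refine X.tendsto_convexNorm_ballAverage_of_absolutelyContinuousNorm hN hp hM hX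
      (hf'm.enorm.pow_const p) (fun x => ENNReal.rpow_ne_top_of_nonneg hp.le enorm_ne_top) ?_
    rw [X.convexNorm_enorm_rpow hp]
    exact ENNReal.rpow_lt_top_of_nonneg hp.le hfX.ne
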